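/- Let $n\ge 1$ and let $H:\{+1,-1\}^n\to\mathbb{R}$ be a cost function with $\sum_z H(z)=0$. Put $E^*=\min_z H(z)$ and $C(E)=|\{z : H(z)\le E\}|$. For $0<\eta<1$ and $x\ge -1$ let $g_\eta(x)=\min\bigl(0,(x+1-\eta)/\eta\bigr)$, and let $g_0$ be the pointwise limit as $\eta\downarrow 0$, i.e. $g_0(-1)=-1$ and $g_0(x)=0$ for $x>-1$. For $b\ge 0$ let $H_b$ be the $n$-qubit Hamiltonian $$H_b=-\frac{1}{n}\sum_{i=1}^n X_i+b\,g_\eta\!\left(\frac{H}{|E^*|}\right),$$ where $X_i$ is the Pauli-$X$ operator on qubit $i$ and $g_\eta(H/|E^*|)$ is the operator that is diagonal in the computational basis $\{|z\rangle\}$ with entries $g_\eta(H(z)/|E^*|)$. Let $E_b$ be the smallest eigenvalue (ground-state energy) of $H_b$. Let $0\le\eta<1$ and suppose that $$C\bigl((1-\eta)E^*\bigr)\le 2^{(1-\gamma)n}$$ for some real number $\gamma\ge (1+4\log_2 n)/n$. (These assumptions force $E^*<0$.) Then for every $b$ with $$0\le b\le \frac{\ln(2)\,\gamma}{2+\ln(2)},$$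 both of the following hold: 1. (large-excited-energy condition) the eigenvalue $E_b$ of $H_b$ is non-degenerate, and every other eigenvalue of $H_b$ is greater than $-1+1/n$; 2. (small-ground-energy-shift condition) $-1-1/n^3\le E_b\le -1$. -/

import Mathlib

noncomputable section

namespace ShortPath

/-- The assignments `{+1,-1}ⁿ`; they also label the computational basis of `n` qubits. -/
abbrev Assignment (n : ℕ) : Type := Fin n → ℤˣ

/-- The assignment `z` with its `i`th bit negated. -/
def flip {n : ℕ} (i : Fin n) (z : Assignment n) : Assignment n :=
  Function.update z i (-z i)

/-- An operator on `n` qubits, as a matrix in the computational basis. -/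
abbrev Operator (n : ℕ) : Type := Matrix (Assignment n) (Assignment n) ℂ

/-- The Pauli-`X` operator on qubit `i`: it sends `|w⟩` to `|flip i w⟩`. -/
def pauliX {n : ℕ} (i : Fin n) : Operator n :=
  Matrix.of fun z w => if z = flip i w then 1 else 0

/-- The transverse field `X = ∑ i, X_i`. -/
def transverseField (n : ℕ) : Operator n := ∑ i, pauliX i

/-- The optimal value `E* = min_z H(z)`. -/
def optimalCost {n : ℕ} (H : Assignment n → ℝ) : ℝ :=
  Finset.univ.inf' Finset.univ_nonempty H

/-- `C(E)`, the number of assignments with cost at most `E`. -/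
def cumulativeCount {n : ℕ} (H : Assignment n → ℝ) (E : ℝ) : ℕ :=
  {z | H z ≤ E}.ncard

/-- The function `g_η(x) = min(0, (x + 1 - η)/η)` on `[-1, ∞)`. For `η = 0` it is the pointwise
limit as `η` decreases to `0`: the value is `-1` at `x = -1` and `0` for `x > -1`. -/
def g (η x : ℝ) : ℝ :=
  if η = 0 then (if x ≤ -1 then -1 else 0) else min 0 ((x + 1 - η) / η)

/-- The Hamiltonian `H_b = -X/n + b g_η(H/|E*|)`. -/
def hamiltonian {n : ℕ} (H : Assignment n → ℝ) (η b : ℝ) : Operator n :=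
  -((1 / (n : ℂ)) • transverseField n) +
    (b : ℂ) • Matrix.diagonal fun z => ((g η (H z / |optimalCost H|) : ℝ) : ℂ)

/-- The energies of a Hamiltonian: its (real) eigenvalues. -/
def energies {n : ℕ} (K : Operator n) : Set ℝ :=
  {E | Module.End.HasEigenvalue (Matrix.toLin' K) (E : ℂ)}

/-- The ground-state energy: the least eigenvalue (the set of eigenvalues of a Hermitian matrix is
finite and non-empty). -/
def groundEnergy {n : ℕ} (K : Operator n) : ℝ := sInf (energies K)

/-- The ground space: the eigenspace of the ground-state energy. -/
def groundSpace {n : ℕ} (K : Operator n) : Submodule ℂ (Assignment n → ℂ) :=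
  Module.End.eigenspace (Matrix.toLin' K) (groundEnergy K : ℂ)

/-- The large-excited-energy condition: the ground state is non-degenerate, and every excited
state has energy greater than `-1 + 1/n`. -/
def LargeExcitedEnergy {n : ℕ} (K : Operator n) : Prop :=
  Module.finrank ℂ (groundSpace K) = 1 ∧
    ∀ E ∈ energies K, E ≠ groundEnergy K → -1 + 1 / (n : ℝ) < E

/-- The small-ground-energy-shift condition: `-1 - 1/n³ ≤ E_b ≤ -1`. -/
def SmallGroundEnergyShift {n : ℕ} (K : Operator n) : Prop :=
  -1 - 1 / (n : ℝ) ^ 3 ≤ groundEnergy K ∧ groundEnergy K ≤ -1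

end ShortPath

end

/-!
Write `⟨K⟩` for the quadratic form of a Hamiltonian `K`. The transverse field is the Dirichlet form
of the hypercube up to an affine change, so `⟨-X/n + V⟩ = 𝓔/n + ⟨V⟩ - ‖ψ‖²`.

The inequality `exp (1 - v) + exp (1 - 1/v) ≥ 2` yields a dual logarithmic Sobolev inequality on
two points, which tensorizes to the hypercube: `-t⟨V⟩ ≤ ‖ψ‖² log (mean of exp (-t V)) + 𝓔`.
With `t = n` it bounds every energy from below. With `t = (2 + log 2) n` it uses up only part of
`𝓔`, and the Poincaré inequality applied to the rest shows `⟨K⟩ > (-1 + 1/n)‖ψ‖²` for all `ψ ≠ 0`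
orthogonal to the uniform superposition. Two independent eigenvectors with energies at most
`-1 + 1/n` would span a plane meeting that hyperplane, so there is at most one such energy and it is
simple. The uniform superposition itself has energy at most `-1`.

Since `-g_η(H/|E*|)` takes values in `[0, 1]` and vanishes off the `C((1-η)E*)` low-cost
assignments, the tail bound controls the exponential moments.
-/

namespace ShortPath

open Finset

theorem monotoneOn_exp_one_sub_add_exp_one_sub_inv :
    MonotoneOn (fun v : ℝ => Real.exp (1 - v) + Real.exp (1 - v⁻¹)) (Set.Ici 1) := by
  have hderiv : ∀ v ∈ Set.Ici (1 : ℝ),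
      HasDerivAt (fun v : ℝ => Real.exp (1 - v) + Real.exp (1 - v⁻¹))
        (Real.exp (1 - v⁻¹) * (v ^ 2)⁻¹ - Real.exp (1 - v)) v := by
    intro v hv
    have hv₀ : v ≠ 0 := (zero_lt_one.trans_le hv).ne'
    refine (((hasDerivAt_id v).const_sub 1).exp.add
      ((hasDerivAt_inv hv₀).const_sub 1).exp).congr_deriv ?_
    rw [id_eq]
    ring
  refine monotoneOn_of_deriv_nonneg (convex_Ici 1)
    (fun v hv => (hderiv v hv).continuousAt.continuousWithinAt)
    (fun v hv => (hderiv v (interior_subset hv)).differentiableAt.differentiableWithinAt)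
    fun v hv => ?_
  replace hv : 1 ≤ v := interior_subset hv
  have hv₀ : 0 < v := by linarith
  have two_log_le : 2 * Real.log v ≤ v - v⁻¹ := by
    have := Real.self_le_sinh_iff.2 (Real.log_nonneg hv)
    rw [Real.sinh_log hv₀] at this
    linarith
  have hsq : v ^ 2 = Real.exp (2 * Real.log v) := by
    rw [two_mul, Real.exp_add, Real.exp_log hv₀, sq]
  rw [(hderiv v hv).deriv, sub_nonneg, hsq, ← Real.exp_neg, ← Real.exp_add, Real.exp_le_exp]
  linarith

theorem two_le_exp_one_sub_add_exp_one_sub_inv {v : ℝ} (hv : 0 < v) :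
    2 ≤ Real.exp (1 - v) + Real.exp (1 - v⁻¹) := by
  wlog h : 1 ≤ v generalizing v
  · simpa only [inv_inv, add_comm] using
      this (inv_pos.2 hv) ((one_le_inv₀ hv).2 (le_of_not_ge h))
  · have := monotoneOn_exp_one_sub_add_exp_one_sub_inv Set.self_mem_Ici h h
    norm_num at this
    exact this

theorem one_sub_log_pos_of_add_eq_two {s t : ℝ} (hs : 0 < s) (ht : 0 < t) (hst : s + t = 2) :
    0 < 1 - Real.log s := by
  linarith [Real.log_le_sub_one_of_pos hs]

theorem inv_one_sub_log_le_of_add_eq_two {s t : ℝ} (hs : 0 < s) (ht : 0 < t) (hst : s + t = 2) :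
    (1 - Real.log s)⁻¹ ≤ 1 - Real.log t := by
  have h := two_le_exp_one_sub_add_exp_one_sub_inv (one_sub_log_pos_of_add_eq_two hs ht hst)
  rw [sub_sub_cancel, Real.exp_log hs] at h
  rw [le_sub_comm, Real.log_le_iff_le_exp ht]
  linarith

theorem two_mul_mul_le_of_add_eq_two {s t : ℝ} (hs : 0 < s) (ht : 0 < t) (hst : s + t = 2)
    (a b : ℝ) : 2 * a * b ≤ a ^ 2 * (1 - Real.log s) + b ^ 2 * (1 - Real.log t) := by
  have hp := one_sub_log_pos_of_add_eq_two hs ht hst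
  have hpq := inv_one_sub_log_le_of_add_eq_two hs ht hst
  set p := 1 - Real.log s
  calc 2 * a * b ≤ 2 * a * b + (a * p - b) ^ 2 / p := le_add_of_nonneg_right (by positivity)
    _ = a ^ 2 * p + b ^ 2 * p⁻¹ := by field_simp; ring
    _ ≤ a ^ 2 * p + b ^ 2 * (1 - Real.log t) := by gcongr

/-- Dual to the primal logarithmic Sobolev inequality through the Gibbs variational principle;
in this form it tensorizes by induction on the dimension. -/
theorem two_point_log_sobolev (a b : ℝ) {s t : ℝ} (hs : 0 < s) (ht : 0 < t) :
    a ^ 2 * Real.log s + b ^ 2 * Real.log t ≤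
      (a ^ 2 + b ^ 2) * Real.log ((s + t) / 2) + (a - b) ^ 2 := by
  have hm : 0 < (s + t) / 2 := by positivity
  have h := two_mul_mul_le_of_add_eq_two (div_pos hs hm) (div_pos ht hm) (by field_simp) a b
  rw [Real.log_div hs.ne' hm.ne', Real.log_div ht.ne' hm.ne'] at h
  linarith

/-- The Dirichlet form `½ ∑ᵢ ∑_z ‖u(z) - u(flip i z)‖²` of the hypercube: each edge is counted
once. -/
noncomputable def dirichlet {n : ℕ} {E : Type*} [SeminormedAddCommGroup E]
    (u : Assignment n → E) : ℝ :=
  (1 / 2) * ∑ i, ∑ z, ‖u z - u (flip i z)‖ ^ 2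

/-- The logarithm of the mean of `exp F` over the hypercube, i.e. the cumulant generating function
of `F` under the uniform distribution. -/
noncomputable def logMeanExp {n : ℕ} (F : Assignment n → ℝ) : ℝ :=
  Real.log ((∑ z, Real.exp (F z)) / 2 ^ n)

theorem flip_flip {n : ℕ} (i : Fin n) (z : Assignment n) : flip i (flip i z) = z := by
  simp [flip]

theorem eq_flip_comm {n : ℕ} {i : Fin n} {z w : Assignment n} : z = flip i w ↔ w = flip i z :=
  (Function.Involutive.eq_iff (flip_flip i)).symm.trans eq_comm

theorem sum_comp_flip {n : ℕ} {M : Type*} [AddCommMonoid M] (i : Fin n) (f : Assignment n → M) :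
    ∑ z, f (flip i z) = ∑ z, f z :=
  Equiv.sum_comp (Function.Involutive.toPerm (flip i) (flip_flip i)) f

theorem flip_zero_cons {n : ℕ} (s : ℤˣ) (z : Assignment n) :
    flip 0 (Fin.cons s z : Assignment (n + 1)) = (Fin.cons (-s) z : Assignment (n + 1)) := by
  simp only [flip, Fin.cons_zero, Fin.update_cons_zero]

theorem flip_succ_cons {n : ℕ} (i : Fin n) (s : ℤˣ) (z : Assignment n) :
    flip i.succ (Fin.cons s z : Assignment (n + 1)) =
      (Fin.cons s (flip i z) : Assignment (n + 1)) := by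
  simp only [flip, Fin.cons_succ, Fin.cons_update]

theorem card_assignment (n : ℕ) : Fintype.card (Assignment n) = 2 ^ n := by
  simp [Assignment]

/-- The restriction of a function on the hypercube to the facet where bit `0` equals `s`. -/
def slice {n : ℕ} {α : Type*} (s : ℤˣ) (f : Assignment (n + 1) → α) : Assignment n → α :=
  fun z => f (Fin.cons s z : Assignment (n + 1))

theorem sum_eq_sum_slice {n : ℕ} {M : Type*} [AddCommMonoid M] (f : Assignment (n + 1) → M) :
    ∑ z, f z = ∑ z, slice 1 f z + ∑ z, slice (-1) f z := by
  rw [← (Fin.consEquiv fun _ : Fin (n + 1) => ℤˣ).sum_comp, Fintype.sum_prod_type,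
    show (univ : Finset ℤˣ) = {1, -1} from rfl, sum_pair (by decide)]
  rfl

section Seminormed

variable {E : Type*} [SeminormedAddCommGroup E]

theorem dirichlet_eq_slice {n : ℕ} (u : Assignment (n + 1) → E) :
    dirichlet u = dirichlet (slice 1 u) + dirichlet (slice (-1) u) +
      ∑ z, ‖slice 1 u z - slice (-1) u z‖ ^ 2 := by
  simp only [dirichlet, Fin.sum_univ_succ, sum_eq_sum_slice, slice, flip_zero_cons,
    flip_succ_cons, neg_neg, sum_add_distrib]
  simp only [norm_sub_rev (u (Fin.cons (-1) _)) (u (Fin.cons 1 _))]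
  ring

theorem sqrt_sum_norm_sq_sub_sq_le {ι : Type*} [Fintype ι] (u v : ι → E) :
    (√(∑ i, ‖u i‖ ^ 2) - √(∑ i, ‖v i‖ ^ 2)) ^ 2 ≤ ∑ i, ‖u i - v i‖ ^ 2 := by
  have h := abs_norm_sub_norm_le (WithLp.toLp 2 u) (WithLp.toLp 2 v)
  rw [PiLp.norm_eq_of_L2, PiLp.norm_eq_of_L2] at h
  have hsq := sq_le_sq.2 (h.trans (le_abs_self _))
  rwa [PiLp.norm_sq_eq_of_L2] at hsq

theorem log_sobolev {n : ℕ} (u : Assignment n → E) (F : Assignment n → ℝ) :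
    ∑ z, ‖u z‖ ^ 2 * F z ≤ (∑ z, ‖u z‖ ^ 2) * logMeanExp F + dirichlet u := by
  induction n with
  | zero => simp [dirichlet, logMeanExp]
  | succ n ih =>
    have mean_pos (F : Assignment n → ℝ) : 0 < (∑ z, Real.exp (F z)) / 2 ^ n :=
      div_pos (sum_pos (fun z _ => Real.exp_pos _) univ_nonempty) (by positivity)
    have h₁ := ih (slice 1 u) (slice 1 F)
    have h₂ := ih (slice (-1) u) (slice (-1) F)
    have htwo := two_point_log_sobolev (√(∑ z, ‖slice 1 u z‖ ^ 2)) (√(∑ z, ‖slice (-1) u z‖ ^ 2))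
      (mean_pos (slice 1 F)) (mean_pos (slice (-1) F))
    have htri := sqrt_sum_norm_sq_sub_sq_le (slice 1 u) (slice (-1) u)
    rw [Real.sq_sqrt (by positivity), Real.sq_sqrt (by positivity), ← add_div, div_div,
      ← pow_succ] at htwo
    rw [dirichlet_eq_slice]
    simp only [logMeanExp, sum_eq_sum_slice, slice] at *
    linarith

theorem neg_mul_sum_mul_norm_sq_le {n : ℕ} (t : ℝ) (V : Assignment n → ℝ) (u : Assignment n → E) :
    -(t * ∑ z, V z * ‖u z‖ ^ 2) ≤
      (∑ z, ‖u z‖ ^ 2) * logMeanExp (fun z => -(t * V z)) + dirichlet u := by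
  refine Eq.trans_le ?_ (log_sobolev u fun z => -(t * V z))
  rw [mul_sum, ← sum_neg_distrib]
  exact sum_congr rfl fun z _ => by ring

theorem norm_sum_sq_le_card_mul {ι : Type*} [Fintype ι] (f : ι → E) :
    ‖∑ i, f i‖ ^ 2 ≤ Fintype.card ι * ∑ i, ‖f i‖ ^ 2 :=
  (pow_le_pow_left₀ (norm_nonneg _) (norm_sum_le univ f) 2).trans sq_sum_le_card_mul_sum_sq

end Seminormed

section InnerProduct

variable {E : Type*} [SeminormedAddCommGroup E] [InnerProductSpace ℝ E]

theorem poincare {n : ℕ} (u : Assignment n → E) :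
    2 * ∑ z, ‖u z‖ ^ 2 ≤ 2 * (‖∑ z, u z‖ ^ 2 / 2 ^ n) + dirichlet u := by
  induction n with
  | zero => simp [dirichlet]
  | succ n ih =>
    set S₁ := ∑ z, slice 1 u z
    set S₂ := ∑ z, slice (-1) u z
    have h₁ : 2 * ∑ z, ‖slice 1 u z‖ ^ 2 ≤ 2 * (‖S₁‖ ^ 2 / 2 ^ n) + _ := ih (slice 1 u)
    have h₂ : 2 * ∑ z, ‖slice (-1) u z‖ ^ 2 ≤ 2 * (‖S₂‖ ^ 2 / 2 ^ n) + _ := ih (slice (-1) u)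
    have hedge : ‖S₁ - S₂‖ ^ 2 / 2 ^ n ≤ ∑ z, ‖slice 1 u z - slice (-1) u z‖ ^ 2 := by
      rw [div_le_iff₀' (by positivity), ← sum_sub_distrib]
      simpa [card_assignment] using
        norm_sum_sq_le_card_mul fun z => slice 1 u z - slice (-1) u z
    have hpar : 2 * (‖S₁‖ ^ 2 / 2 ^ n) + 2 * (‖S₂‖ ^ 2 / 2 ^ n) =
        2 * (‖S₁ + S₂‖ ^ 2 / 2 ^ (n + 1)) + ‖S₁ - S₂‖ ^ 2 / 2 ^ n := by
      rw [pow_succ (2 : ℝ), div_mul_eq_div_div]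
      linear_combination (-1 / 2 ^ n) * parallelogram_law_with_norm ℝ S₁ S₂
    have hnorm : ∑ z, ‖u z‖ ^ 2 = ∑ z, ‖slice 1 u z‖ ^ 2 + ∑ z, ‖slice (-1) u z‖ ^ 2 :=
      sum_eq_sum_slice _
    rw [dirichlet_eq_slice, sum_eq_sum_slice u, hnorm]
    linarith

theorem dirichlet_eq {n : ℕ} (u : Assignment n → E) :
    dirichlet u = n * ∑ z, ‖u z‖ ^ 2 - ∑ i, ∑ z, inner ℝ (u z) (u (flip i z)) := by
  have hedge (i : Fin n) : ∑ z, ‖u z - u (flip i z)‖ ^ 2 =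
      2 * ∑ z, ‖u z‖ ^ 2 - 2 * ∑ z, inner ℝ (u z) (u (flip i z)) := by
    simp only [norm_sub_sq_real, sum_add_distrib, sum_sub_distrib, ← mul_sum,
      sum_comp_flip i fun z => ‖u z‖ ^ 2]
    ring
  simp only [dirichlet, hedge, sum_sub_distrib, ← mul_sum, sum_const, card_univ, Fintype.card_fin,
    nsmul_eq_mul]
  ring

end InnerProduct

open Matrix

open scoped ComplexOrder

section Matrix

variable {m : Type*} [Fintype m] {K : Matrix m m ℂ} {φ ψ : m → ℂ} {E F c : ℝ}

/-- The (real part of the) unnormalized expectation value `⟨ψ|K|ψ⟩` of an observable `K`. -/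
noncomputable def expectation (K : Matrix m m ℂ) (ψ : m → ℂ) : ℝ := (star ψ ⬝ᵥ K *ᵥ ψ).re

theorem star_dotProduct_self (ψ : m → ℂ) : star ψ ⬝ᵥ ψ = ((∑ i, ‖ψ i‖ ^ 2 : ℝ) : ℂ) := by
  simp [dotProduct, Complex.conj_mul']

theorem sum_norm_sq_pos (h : ψ ≠ 0) : 0 < ∑ i, ‖ψ i‖ ^ 2 := by
  rw [← Complex.zero_lt_real, ← star_dotProduct_self]
  exact dotProduct_star_self_pos_iff.2 h

theorem expectation_one [DecidableEq m] : expectation 1 ψ = ∑ i, ‖ψ i‖ ^ 2 := by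
  rw [expectation, one_mulVec, star_dotProduct_self, Complex.ofReal_re]

theorem expectation_of_mulVec_eq_smul (hψ : K *ᵥ ψ = (E : ℂ) • ψ) :
    expectation K ψ = E * ∑ i, ‖ψ i‖ ^ 2 := by
  rw [expectation, hψ, dotProduct_smul, star_dotProduct_self, smul_eq_mul, ← Complex.ofReal_mul,
    Complex.ofReal_re]

theorem expectation_add_of_orthogonal (h : star φ ⬝ᵥ K *ᵥ ψ = 0) (h' : star ψ ⬝ᵥ K *ᵥ φ = 0) :
    expectation K (φ + ψ) = expectation K φ + expectation K ψ := by
  simp only [expectation, star_add, mulVec_add, add_dotProduct, dotProduct_add, h, h', add_zero,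
    zero_add, Complex.add_re]

theorem star_dotProduct_eq_zero_of_ne (hK : K.IsHermitian) (hEF : E ≠ F)
    (hφ : K *ᵥ φ = (E : ℂ) • φ) (hψ : K *ᵥ ψ = (F : ℂ) • ψ) : star φ ⬝ᵥ ψ = 0 := by
  have h : star φ ⬝ᵥ K *ᵥ ψ = star (K *ᵥ φ) ⬝ᵥ ψ := by
    rw [star_mulVec, hK.eq, dotProduct_mulVec]
  rw [hφ, hψ, dotProduct_smul, star_smul, smul_dotProduct, Complex.star_def,
    Complex.conj_ofReal, ← sub_eq_zero, ← sub_smul, smul_eq_zero, sub_eq_zero,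
    Complex.ofReal_inj] at h
  exact h.resolve_left hEF.symm

theorem expectation_add_le (hK : K.IsHermitian) (hEF : E ≠ F) (hE : E ≤ c) (hF : F ≤ c)
    (hφ : K *ᵥ φ = (E : ℂ) • φ) (hψ : K *ᵥ ψ = (F : ℂ) • ψ) :
    expectation K (φ + ψ) ≤ c * ∑ i, ‖(φ + ψ) i‖ ^ 2 := by
  classical
  have hφψ := star_dotProduct_eq_zero_of_ne hK hEF hφ hψ
  have hψφ := star_dotProduct_eq_zero_of_ne hK hEF.symm hψ hφ
  rw [← expectation_one (ψ := φ + ψ), expectation_add_of_orthogonal (K := 1)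
    (by rwa [one_mulVec]) (by rwa [one_mulVec]), expectation_add_of_orthogonal
    (by rw [hψ, dotProduct_smul, hφψ, smul_zero]) (by rw [hφ, dotProduct_smul, hψφ, smul_zero]),
    expectation_of_mulVec_eq_smul hφ, expectation_of_mulVec_eq_smul hψ, expectation_one,
    expectation_one, mul_add]
  gcongr

section Hyperplane

variable {ℓ : (m → ℂ) →ₗ[ℂ] ℂ}

theorem eq_zero_of_forall_lt_expectation
    (hform : ∀ ψ, ℓ ψ = 0 → ψ ≠ 0 → c * ∑ i, ‖ψ i‖ ^ 2 < expectation K ψ)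
    (hE : E ≤ c) (hψ : K *ᵥ ψ = (E : ℂ) • ψ) (hℓ : ℓ ψ = 0) : ψ = 0 := by
  by_contra h₀
  have h := hform ψ hℓ h₀
  rw [expectation_of_mulVec_eq_smul hψ] at h
  exact h.not_ge (by gcongr)

theorem finrank_eigenspace_le_one_of_forall_lt_expectation [DecidableEq m]
    (hform : ∀ ψ, ℓ ψ = 0 → ψ ≠ 0 → c * ∑ i, ‖ψ i‖ ^ 2 < expectation K ψ) (hE : E ≤ c) :
    Module.finrank ℂ (Module.End.eigenspace (Matrix.toLin' K) (E : ℂ)) ≤ 1 := by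
  set V := Module.End.eigenspace (Matrix.toLin' K) (E : ℂ)
  have hinj : Function.Injective (ℓ.comp V.subtype) := by
    rw [injective_iff_map_eq_zero]
    rintro ⟨ψ, hψ⟩ hℓ
    exact Subtype.ext <|
      eq_zero_of_forall_lt_expectation hform hE (Module.End.mem_eigenspace_iff.1 hψ) hℓ
  simpa only [Module.finrank_self] using LinearMap.finrank_le_finrank_of_injective hinj

theorem lt_of_ne_of_forall_lt_expectation (hK : K.IsHermitian)
    (hform : ∀ ψ, ℓ ψ = 0 → ψ ≠ 0 → c * ∑ i, ‖ψ i‖ ^ 2 < expectation K ψ) (hE : E ≤ c)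
    (hEF : E ≠ F) (hφ : K *ᵥ φ = (E : ℂ) • φ) (hφ₀ : φ ≠ 0) (hψ : K *ᵥ ψ = (F : ℂ) • ψ)
    (hψ₀ : ψ ≠ 0) : c < F := by
  by_contra! hF
  have hφ' : K *ᵥ (ℓ ψ • φ) = (E : ℂ) • (ℓ ψ • φ) := by rw [mulVec_smul, hφ, smul_comm]
  have hψ' : K *ᵥ (-ℓ φ • ψ) = (F : ℂ) • (-ℓ φ • ψ) := by rw [mulVec_smul, hψ, smul_comm]
  have hcomb : ℓ ψ • φ + -ℓ φ • ψ = 0 := by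
    by_contra h₀
    refine (hform _ ?_ h₀).not_ge (expectation_add_le hK hEF hE hF hφ' hψ')
    rw [map_add, map_smul, map_smul, smul_eq_mul, smul_eq_mul]
    ring
  have horth : star φ ⬝ᵥ (ℓ ψ • φ + -ℓ φ • ψ) = ℓ ψ * (star φ ⬝ᵥ φ) := by
    rw [dotProduct_add, dotProduct_smul, dotProduct_smul,
      star_dotProduct_eq_zero_of_ne hK hEF hφ hψ, smul_zero, add_zero, smul_eq_mul]
  rw [hcomb, dotProduct_zero, zero_eq_mul, dotProduct_star_self_eq_zero] at horth
  exact hψ₀ (eq_zero_of_forall_lt_expectation hform hF hψ (horth.resolve_right hφ₀))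

end Hyperplane

end Matrix

section Energies

variable {n : ℕ} {K : Operator n} {E c : ℝ}

theorem mem_energies_iff :
    E ∈ energies K ↔ ∃ ψ : Assignment n → ℂ, K *ᵥ ψ = (E : ℂ) • ψ ∧ ψ ≠ 0 := by
  constructor
  · intro hE
    obtain ⟨ψ, hψ, hψ₀⟩ := Module.End.HasEigenvalue.exists_hasEigenvector hE
    exact ⟨ψ, Module.End.mem_eigenspace_iff.1 hψ, hψ₀⟩
  · rintro ⟨ψ, hψ, hψ₀⟩
    exact Module.End.hasEigenvalue_of_hasEigenvector
      ⟨Module.End.mem_eigenspace_iff.2 hψ, hψ₀⟩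

theorem energies_eq_spectrum (K : Operator n) : energies K = spectrum ℝ K := by
  ext E
  rw [← spectrum.algebraMap_mem_iff ℂ, ← Matrix.spectrum_toLin',
    ← Module.End.hasEigenvalue_iff_mem_spectrum]
  rfl

theorem energies_finite (K : Operator n) : (energies K).Finite :=
  (Module.End.finite_hasEigenvalue (Matrix.toLin' K)).preimage Complex.ofReal_injective.injOn

theorem exists_mem_energies_le_of_expectation_le (hK : K.IsHermitian) {ψ : Assignment n → ℂ}
    (hψ : ψ ≠ 0) (h : expectation K ψ ≤ c * ∑ z, ‖ψ z‖ ^ 2) : ∃ E ∈ energies K, E ≤ c := by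
  by_contra! hc
  have hshift : (K - algebraMap ℝ (Operator n) c).IsHermitian :=
    hK.sub (IsSelfAdjoint.algebraMap _ (.all c))
  have hpos : (K - algebraMap ℝ (Operator n) c).PosDef := by
    refine hshift.posDef_iff_eigenvalues_pos.2 fun j => ?_
    have hj : hshift.eigenvalues j ∈ spectrum ℝ (K - algebraMap ℝ (Operator n) c) :=
      hshift.spectrum_real_eq_range_eigenvalues ▸ Set.mem_range_self j
    rw [← spectrum.sub_singleton_eq, ← energies_eq_spectrum, Set.sub_singleton] at hj
    obtain ⟨E, hE, hEj⟩ := hj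
    exact hEj ▸ sub_pos.2 (hc E hE)
  have hlt : 0 < (star ψ ⬝ᵥ (K - algebraMap ℝ (Operator n) c) *ᵥ ψ).re := hpos.re_dotProduct_pos hψ
  rw [Algebra.algebraMap_eq_smul_one, sub_mulVec, smul_mulVec, one_mulVec, dotProduct_sub,
    dotProduct_smul, star_dotProduct_self, Complex.sub_re, Complex.smul_re, Complex.ofReal_re,
    smul_eq_mul, sub_pos] at hlt
  exact hlt.not_ge h

theorem groundEnergy_mem_energies (h : (energies K).Nonempty) : groundEnergy K ∈ energies K :=
  h.csInf_mem (energies_finite K)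

theorem groundEnergy_le (hE : E ∈ energies K) : groundEnergy K ≤ E :=
  csInf_le (energies_finite K).bddBelow hE

end Energies

/-- The Hamiltonian `-X/n + V` of a transverse field of total strength one in an arbitrary diagonal
potential `V`. -/
noncomputable def fieldHamiltonian {n : ℕ} (V : Assignment n → ℝ) : Operator n :=
  -((1 / (n : ℂ)) • transverseField n) + diagonal fun z => (V z : ℂ)

section FieldHamiltonian

variable {n : ℕ} {V : Assignment n → ℝ}

theorem hamiltonian_eq_fieldHamiltonian (H : Assignment n → ℝ) (η b : ℝ) :
    hamiltonian H η b = fieldHamiltonian fun z => b * g η (H z / |optimalCost H|) := by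
  rw [hamiltonian, fieldHamiltonian, ← diagonal_smul]
  congr 2
  ext z
  simp

theorem pauliX_mulVec (i : Fin n) (ψ : Assignment n → ℂ) (z : Assignment n) :
    (pauliX i *ᵥ ψ) z = ψ (flip i z) := by
  simp [pauliX, mulVec, dotProduct, eq_flip_comm (z := z)]

theorem pauliX_isHermitian (i : Fin n) : (pauliX i).IsHermitian := by
  ext z w
  simp [pauliX, conjTranspose_apply, eq_flip_comm (z := w), apply_ite]

theorem fieldHamiltonian_isHermitian (V : Assignment n → ℝ) : (fieldHamiltonian V).IsHermitian := by
  have hX : (transverseField n).IsHermitian :=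
    isSelfAdjoint_sum _ fun i _ => pauliX_isHermitian i
  refine ((hX.smul ?_).neg).add (isHermitian_diagonal_of_self_adjoint _ ?_)
  · simp [IsSelfAdjoint]
  · ext z
    simp

theorem expectation_fieldHamiltonian (hn : 1 ≤ n) (ψ : Assignment n → ℂ) :
    expectation (fieldHamiltonian V) ψ = dirichlet ψ / n + ∑ z, (V z - 1) * ‖ψ z‖ ^ 2 := by
  have hn₀ : (n : ℝ) ≠ 0 := by positivity
  have hfield : (star ψ ⬝ᵥ transverseField n *ᵥ ψ).re = n * ∑ z, ‖ψ z‖ ^ 2 - dirichlet ψ := by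
    rw [dirichlet_eq, sub_sub_cancel, transverseField, sum_mulVec, dotProduct_sum, Complex.re_sum]
    simp only [dotProduct, pauliX_mulVec, Complex.re_sum, Pi.star_apply, Complex.inner,
      Complex.star_def, mul_comm]
  have hdiag : (star ψ ⬝ᵥ (diagonal fun z => (V z : ℂ)) *ᵥ ψ).re = ∑ z, V z * ‖ψ z‖ ^ 2 := by
    simp only [dotProduct, mulVec_diagonal, Pi.star_apply, Complex.star_def,
      mul_left_comm _ (Complex.ofReal _), Complex.conj_mul']
    norm_cast
  have hscale (w : ℂ) : (1 / (n : ℂ) * w).re = w.re / n := by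
    rw [one_div_mul_eq_div, Complex.div_natCast_re]
  rw [expectation, fieldHamiltonian, add_mulVec, neg_mulVec, smul_mulVec, dotProduct_add,
    dotProduct_neg, dotProduct_smul, Complex.add_re, Complex.neg_re, smul_eq_mul, hscale, hfield,
    hdiag]
  simp only [sub_mul, one_mul, sum_sub_distrib]
  field_simp
  ring

theorem neg_one_sub_mul_le_expectation (hn : 1 ≤ n) (V : Assignment n → ℝ) (ψ : Assignment n → ℂ) :
    (-1 - logMeanExp (fun z => -(n * V z)) / n) * ∑ z, ‖ψ z‖ ^ 2 ≤
      expectation (fieldHamiltonian V) ψ := by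
  have hn₀ : (0 : ℝ) < n := by positivity
  have hsob := neg_mul_sum_mul_norm_sq_le n V ψ
  rw [expectation_fieldHamiltonian hn]
  simp only [sub_mul, one_mul, sum_sub_distrib]
  rw [← mul_le_mul_iff_right₀ hn₀]
  field_simp
  linarith

/-- The share `1 / κ` of the Dirichlet form absorbs the potential through the logarithmic Sobolev
inequality; the Poincaré inequality for the rest gives the spectral gap. -/
theorem mul_lt_expectation_of_sum_eq_zero (hn : 1 ≤ n) {κ : ℝ} (hκ : 1 ≤ κ)
    (hV : logMeanExp (fun z => -(n * κ * V z)) < κ - 2)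
    {ψ : Assignment n → ℂ} (hsum : ∑ z, ψ z = 0) (hψ : ψ ≠ 0) :
    (-1 + 1 / (n : ℝ)) * ∑ z, ‖ψ z‖ ^ 2 < expectation (fieldHamiltonian V) ψ := by
  have hκ₀ : 0 < κ := by positivity
  have hn₀ : (0 : ℝ) < n := by positivity
  have hsob := neg_mul_sum_mul_norm_sq_le (n * κ) V ψ
  have hlog := mul_lt_mul_of_pos_left hV (sum_norm_sq_pos hψ)
  have hgap : 2 * ∑ z, ‖ψ z‖ ^ 2 ≤ dirichlet ψ := by
    simpa [hsum] using poincare ψ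
  have hrest := mul_le_mul_of_nonneg_left hgap (sub_nonneg.2 hκ)
  rw [expectation_fieldHamiltonian hn]
  simp only [sub_mul, one_mul, sum_sub_distrib]
  rw [← mul_lt_mul_iff_right₀ hn₀]
  field_simp
  rw [← mul_lt_mul_iff_right₀ hκ₀]
  linarith

theorem exists_mem_energies_le_neg_one (hn : 1 ≤ n) (hV : ∑ z, V z ≤ 0) :
    ∃ E ∈ energies (fieldHamiltonian V), E ≤ -1 := by
  refine exists_mem_energies_le_of_expectation_le (fieldHamiltonian_isHermitian V)
    (one_ne_zero : (1 : Assignment n → ℂ) ≠ 0) ?_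
  rw [expectation_fieldHamiltonian hn]
  simpa [dirichlet] using hV

theorem groundEnergy_fieldHamiltonian_mem_energies (hn : 1 ≤ n) (hV : ∑ z, V z ≤ 0) :
    groundEnergy (fieldHamiltonian V) ∈ energies (fieldHamiltonian V) := by
  obtain ⟨E, hE, -⟩ := exists_mem_energies_le_neg_one hn hV
  exact groundEnergy_mem_energies ⟨E, hE⟩

theorem groundEnergy_fieldHamiltonian_le_neg_one (hn : 1 ≤ n) (hV : ∑ z, V z ≤ 0) :
    groundEnergy (fieldHamiltonian V) ≤ -1 := by
  obtain ⟨E, hE, hE₁⟩ := exists_mem_energies_le_neg_one hn hV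
  exact (groundEnergy_le hE).trans hE₁

theorem neg_one_sub_le_of_mem_energies (hn : 1 ≤ n) {E : ℝ}
    (hE : E ∈ energies (fieldHamiltonian V)) :
    -1 - logMeanExp (fun z => -(n * V z)) / n ≤ E := by
  obtain ⟨ψ, hψ, hψ₀⟩ := mem_energies_iff.1 hE
  refine le_of_mul_le_mul_right ?_ (sum_norm_sq_pos hψ₀)
  exact (neg_one_sub_mul_le_expectation hn V ψ).trans_eq (expectation_of_mulVec_eq_smul hψ)

theorem largeExcitedEnergy_fieldHamiltonian (hn : 1 ≤ n) (hV : ∑ z, V z ≤ 0) {κ : ℝ} (hκ : 1 ≤ κ)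
    (hlog : logMeanExp (fun z => -(n * κ * V z)) < κ - 2) :
    LargeExcitedEnergy (fieldHamiltonian V) := by
  have hform : ∀ ψ, (∑ z, LinearMap.proj z : (Assignment n → ℂ) →ₗ[ℂ] ℂ) ψ = 0 → ψ ≠ 0 →
      (-1 + 1 / (n : ℝ)) * ∑ z, ‖ψ z‖ ^ 2 < expectation (fieldHamiltonian V) ψ := fun ψ hsum =>
    mul_lt_expectation_of_sum_eq_zero hn hκ hlog (by simpa using hsum)
  have hground := groundEnergy_fieldHamiltonian_mem_energies hn hV
  have hle : groundEnergy (fieldHamiltonian V) ≤ -1 + 1 / (n : ℝ) :=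
    (groundEnergy_fieldHamiltonian_le_neg_one hn hV).trans (le_add_of_nonneg_right (by positivity))
  refine ⟨(finrank_eigenspace_le_one_of_forall_lt_expectation hform hle).antisymm
    (Submodule.one_le_finrank_iff.2 hground), fun E hE hne => ?_⟩
  obtain ⟨φ, hφ, hφ₀⟩ := mem_energies_iff.1 hground
  obtain ⟨ψ, hψ, hψ₀⟩ := mem_energies_iff.1 hE
  exact lt_of_ne_of_forall_lt_expectation (fieldHamiltonian_isHermitian V) hform hle hne.symm
    hφ hφ₀ hψ hψ₀

end FieldHamiltonian

theorem g_nonpos (η x : ℝ) : g η x ≤ 0 := by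
  unfold g
  split_ifs <;> simp

theorem neg_one_le_g {η x : ℝ} (hη : 0 ≤ η) (hx : -1 ≤ x) : -1 ≤ g η x := by
  rcases hη.eq_or_lt with rfl | hη
  · rw [g, if_pos rfl]
    split_ifs <;> norm_num
  · rw [g, if_neg hη.ne', le_inf_iff, le_div_iff₀ hη]
    exact ⟨by norm_num, by linarith⟩

theorem g_eq_zero {η x : ℝ} (hη : 0 ≤ η) (hx : -(1 - η) < x) : g η x = 0 := by
  rcases hη.eq_or_lt with rfl | hη
  · rw [g, if_pos rfl, if_neg (by linarith)]
  · rw [g, if_neg hη.ne', inf_eq_left]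
    exact div_nonneg (by linarith) hη.le

section Cost

variable {n : ℕ} {H : Assignment n → ℝ} {η γ t : ℝ}

theorem optimalCost_le (H : Assignment n → ℝ) (z : Assignment n) : optimalCost H ≤ H z :=
  inf'_le _ (mem_univ z)

theorem optimalCost_nonpos (hH : ∑ z, H z = 0) : optimalCost H ≤ 0 := by
  obtain ⟨z, -, hz⟩ := exists_le_of_sum_le univ_nonempty (hH.trans sum_const_zero.symm).le
  exact (optimalCost_le H z).trans hz

theorem cumulativeCount_eq_card (H : Assignment n → ℝ) (E : ℝ) :
    cumulativeCount H E = #{z | H z ≤ E} := by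
  rw [cumulativeCount, ← Set.ncard_coe_finset, coe_filter_univ]

theorem two_rpow_one_sub_mul (γ : ℝ) (n : ℕ) :
    (2 : ℝ) ^ ((1 - γ) * n) = 2 ^ n * Real.exp (-(Real.log 2 * γ * n)) := by
  rw [sub_mul, one_mul, sub_eq_add_neg, Real.rpow_add two_pos, Real.rpow_natCast,
    Real.rpow_def_of_pos two_pos]
  ring_nf

theorem optimalCost_neg (hn : 1 ≤ n) (hH : ∑ z, H z = 0) (hγ : 0 < γ)
    (htail : (cumulativeCount H ((1 - η) * optimalCost H) : ℝ) ≤ (2 : ℝ) ^ ((1 - γ) * (n : ℝ))) :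
    optimalCost H < 0 := by
  refine (optimalCost_nonpos hH).lt_of_ne fun hE => ?_
  have hzero : ∀ z, H z = 0 := fun z =>
    (sum_eq_zero_iff_of_nonneg fun z _ => hE ▸ optimalCost_le H z).1 hH z (mem_univ z)
  have hcount : cumulativeCount H ((1 - η) * optimalCost H) = 2 ^ n := by
    simp [cumulativeCount_eq_card, hE, hzero]
  have hexp : Real.exp (-(Real.log 2 * γ * n)) < 1 :=
    Real.exp_lt_one_iff.2 (neg_lt_zero.2 (by positivity))
  rw [hcount, two_rpow_one_sub_mul, Nat.cast_pow, Nat.cast_ofNat] at htail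
  exact htail.not_gt (mul_lt_of_lt_one_right (by positivity) hexp)

theorem neg_one_le_cost_div (hE : optimalCost H < 0) (z : Assignment n) :
    -1 ≤ H z / |optimalCost H| := by
  rw [abs_of_neg hE, le_div_iff₀ (neg_pos.2 hE)]
  linarith [optimalCost_le H z]

theorem g_cost_div_eq_zero (hE : optimalCost H < 0) (hη : 0 ≤ η) {z : Assignment n}
    (hz : (1 - η) * optimalCost H < H z) : g η (H z / |optimalCost H|) = 0 := by
  refine g_eq_zero hη ?_
  rw [abs_of_neg hE, lt_div_iff₀ (neg_pos.2 hE)]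
  linarith

theorem sum_exp_neg_mul_g_le (hE : optimalCost H < 0) (hη : 0 ≤ η) (ht : 0 ≤ t) :
    ∑ z, Real.exp (-(t * g η (H z / |optimalCost H|))) ≤
      2 ^ n + cumulativeCount H ((1 - η) * optimalCost H) * (Real.exp t - 1) := by
  calc ∑ z, Real.exp (-(t * g η (H z / |optimalCost H|)))
      ≤ ∑ z, (1 + if H z ≤ (1 - η) * optimalCost H then Real.exp t - 1 else 0) := by
        refine sum_le_sum fun z _ => ?_
        split_ifs with hz
        · rw [add_sub_cancel, Real.exp_le_exp, ← mul_neg]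
          exact mul_le_of_le_one_right ht
            (neg_le.2 (neg_one_le_g hη (neg_one_le_cost_div hE z)))
        · simp [g_cost_div_eq_zero hE hη (not_le.1 hz)]
    _ = _ := by
        rw [sum_add_distrib, ← sum_filter, sum_const, sum_const, cumulativeCount_eq_card,
          card_univ, card_assignment]
        simp

theorem logMeanExp_neg_mul_g_le (hE : optimalCost H < 0) (hη : 0 ≤ η)
    (htail : (cumulativeCount H ((1 - η) * optimalCost H) : ℝ) ≤ (2 : ℝ) ^ ((1 - γ) * (n : ℝ)))
    (ht : 0 ≤ t) :
    logMeanExp (fun z => -(t * g η (H z / |optimalCost H|))) ≤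
      Real.log (1 + Real.exp (-(Real.log 2 * γ * n)) * (Real.exp t - 1)) := by
  have ht₁ : 0 ≤ Real.exp t - 1 := sub_nonneg.2 (Real.one_le_exp ht)
  refine Real.log_le_log (by positivity) ?_
  rw [div_le_iff₀' (by positivity), mul_add, mul_one, ← mul_assoc, ← two_rpow_one_sub_mul]
  exact (sum_exp_neg_mul_g_le hE hη ht).trans (by gcongr)

theorem exp_neg_log_two_mul_le (hn : 1 ≤ n) (hγ : 4 * Real.logb 2 n / n ≤ γ) :
    Real.exp (-(Real.log 2 * γ * n / 2)) ≤ 1 / (n : ℝ) ^ 2 := by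
  have hn₀ : (0 : ℝ) < n := by positivity
  have hlog : Real.logb 2 n * Real.log 2 = Real.log n :=
    div_mul_cancel₀ _ (Real.log_pos one_lt_two).ne'
  rw [div_le_iff₀ hn₀] at hγ
  rw [one_div, Real.exp_neg, inv_le_inv₀ (Real.exp_pos _) (by positivity),
    ← Real.log_le_iff_le_exp (by positivity), Real.log_pow, ← hlog]
  push_cast
  nlinarith [Real.log_pos one_lt_two]

theorem logMeanExp_le_one_div_sq (hn : 1 ≤ n) (hE : optimalCost H < 0) (hη : 0 ≤ η)
    (htail : (cumulativeCount H ((1 - η) * optimalCost H) : ℝ) ≤ (2 : ℝ) ^ ((1 - γ) * (n : ℝ)))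
    (hγ : 4 * Real.logb 2 n / n ≤ γ) (ht : 0 ≤ t) (htγ : 2 * t ≤ Real.log 2 * γ * n) :
    logMeanExp (fun z => -(t * g η (H z / |optimalCost H|))) ≤ 1 / (n : ℝ) ^ 2 := by
  set a := Real.log 2 * γ * n
  have ht₁ : 0 ≤ Real.exp t - 1 := sub_nonneg.2 (Real.one_le_exp ht)
  calc logMeanExp (fun z => -(t * g η (H z / |optimalCost H|)))
      ≤ Real.log (1 + Real.exp (-a) * (Real.exp t - 1)) := logMeanExp_neg_mul_g_le hE hη htail ht
    _ ≤ Real.exp (-a) * (Real.exp t - 1) := by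
        linarith [Real.log_le_sub_one_of_pos
          (by positivity : 0 < 1 + Real.exp (-a) * (Real.exp t - 1))]
    _ ≤ Real.exp (-a) * Real.exp t := by gcongr; exact sub_le_self _ zero_le_one
    _ ≤ Real.exp (-(a / 2)) := by
        rw [← Real.exp_add, Real.exp_le_exp]
        linarith
    _ ≤ 1 / (n : ℝ) ^ 2 := exp_neg_log_two_mul_le hn hγ

theorem logMeanExp_lt_log_two (hE : optimalCost H < 0) (hη : 0 ≤ η)
    (htail : (cumulativeCount H ((1 - η) * optimalCost H) : ℝ) ≤ (2 : ℝ) ^ ((1 - γ) * (n : ℝ)))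
    (ht : 0 ≤ t) (htγ : t ≤ Real.log 2 * γ * n) :
    logMeanExp (fun z => -(t * g η (H z / |optimalCost H|))) < Real.log 2 := by
  have ht₁ : 0 ≤ Real.exp t - 1 := sub_nonneg.2 (Real.one_le_exp ht)
  refine (logMeanExp_neg_mul_g_le hE hη htail ht).trans_lt
    (Real.log_lt_log (by positivity) ?_)
  have hexp : Real.exp (-(Real.log 2 * γ * n)) * Real.exp t ≤ 1 := by
    rw [← Real.exp_add, Real.exp_le_one_iff]
    linarith
  linarith [Real.exp_pos (-(Real.log 2 * γ * n))]

end Cost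

end ShortPath

open ShortPath in
theorem mainTheorem6_general (n : ℕ) (hn : 1 ≤ n) (H : Assignment n → ℝ)
    (hE : optimalCost H < 0) (η γ : ℝ) (hη : 0 ≤ η)
    (htail : (cumulativeCount H ((1 - η) * optimalCost H) : ℝ) ≤ (2 : ℝ) ^ ((1 - γ) * (n : ℝ)))
    (hγ : 4 * Real.logb 2 (n : ℝ) / (n : ℝ) ≤ γ)
    (b : ℝ) (hb₀ : 0 ≤ b) (hb : b ≤ Real.log 2 * γ / (2 + Real.log 2)) :
    LargeExcitedEnergy (hamiltonian H η b) ∧ SmallGroundEnergyShift (hamiltonian H η b) := by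
  have hlog2 : 0 < Real.log 2 := Real.log_pos one_lt_two
  have hV : ∑ z, b * g η (H z / |optimalCost H|) ≤ 0 :=
    Finset.sum_nonpos fun z _ => mul_nonpos_of_nonneg_of_nonpos hb₀ (g_nonpos _ _)
  rw [le_div_iff₀ (by positivity)] at hb
  have hnb : n * (2 + Real.log 2) * b ≤ Real.log 2 * γ * n := by
    linarith [mul_le_mul_of_nonneg_left hb n.cast_nonneg]
  have hnb₂ : 2 * (n * b) ≤ Real.log 2 * γ * n := by
    linarith [show 0 ≤ n * b * Real.log 2 by positivity]
  rw [hamiltonian_eq_fieldHamiltonian]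
  refine ⟨largeExcitedEnergy_fieldHamiltonian hn hV (κ := 2 + Real.log 2) (by linarith) ?_, ?_,
    groundEnergy_fieldHamiltonian_le_neg_one hn hV⟩
  · simpa only [add_sub_cancel_left, mul_assoc] using
      logMeanExp_lt_log_two hE hη htail (by positivity) hnb
  · have hshift := logMeanExp_le_one_div_sq hn hE hη htail hγ (by positivity) hnb₂
    have hground := neg_one_sub_le_of_mem_energies hn
      (groundEnergy_fieldHamiltonian_mem_energies hn hV)
    simp only [mul_assoc] at hshift hground
    refine le_trans ?_ hground
    rw [pow_succ, ← div_div]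
    gcongr

theorem mainTheorem6 (n : ℕ) (hn : 1 ≤ n) (H : ShortPath.Assignment n → ℝ)
    (hH : ∑ z, H z = 0) (η γ : ℝ) (hη₀ : 0 ≤ η) (hη₁ : η < 1)
    (htail : (ShortPath.cumulativeCount H ((1 - η) * ShortPath.optimalCost H) : ℝ) ≤
      (2 : ℝ) ^ ((1 - γ) * (n : ℝ)))
    (hγ : (1 + 4 * Real.logb 2 (n : ℝ)) / (n : ℝ) ≤ γ)
    (b : ℝ) (hb₀ : 0 ≤ b) (hb : b ≤ Real.log 2 * γ / (2 + Real.log 2)) :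
    ShortPath.LargeExcitedEnergy (ShortPath.hamiltonian H η b) ∧
      ShortPath.SmallGroundEnergyShift (ShortPath.hamiltonian H η b) := by
  have hlogb : 0 ≤ Real.logb 2 n := Real.logb_nonneg one_lt_two (by exact_mod_cast hn)
  have hγ₀ : 0 < γ := lt_of_lt_of_le (by positivity) hγ
  exact mainTheorem6_general n hn H (ShortPath.optimalCost_neg hn hH hγ₀ htail) η γ hη₀ htail
    (le_trans (by gcongr; linarith) hγ) b hb₀ hb
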